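/- Let $K$ be a field, $S=K[x_1,\dots,x_n]$, and let $I\subset S$ be a monomial ideal of height $2$ such that $S/I$ is Cohen–Macaulay. Let $u_1,\dots,u_{m+1}$ be the minimal monomial generators of $I$, listed without repetition. For $i<j$ let $$r_{ij}=\frac{u_i}{\gcd(u_i,u_j)}\,e_j-\frac{u_j}{\gcd(u_i,u_j)}\,e_i\in S^{m+1}$$ be the Taylor relation of $u_i,u_j$. A Hilbert–Burch matrix of $I$ is an $m\times(m+1)$ matrix $A$ over $S$, each of whose rows is a Taylor relation, such that $$0\to S^m\xrightarrow{\ v\mapsto vA\ }S^{m+1}\xrightarrow{\ e_i\mapsto u_i\ }S\to S/I\to 0$$ is a minimal free resolution of $S/I$. To $A$ one attaches the graph $\Gamma_A$ on the vertex set $\{1,\dots,m+1\}$ in which $\{i,j\}$, $i\neq j$, is an edge if and only if some row of $A$ has its nonzero entries exactly in the $i$th and $j$th positions. Let $\mathcal T(I)$ be the set of all graphs $\Gamma_A$, where $A$ runs over the Hilbert–Burch matrices of $I$. Then every $\Gamma\in\mathcal T(I)$ is a tree (the elements of $\mathcal T(I)$ are called the relation trees of $I$), and the edge sets $E(\Gamma)$,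 $\Gamma\in\mathcal T(I)$, are exactly the bases of a matroid on the set of all two-element subsets of $\{1,\dots,m+1\}$. In particular, $\mathcal T(I)$ is non-empty. -/

import Mathlib

open MvPolynomial

noncomputable section

namespace RelationTrees

/-- A Noetherian local ring `R` is Cohen--Macaulay if its maximal ideal contains a regular
sequence whose length is the Krull dimension of `R` (that is, depth `R` = dim `R`). -/
structure IsCohenMacaulayLocalRing (R : Type*) [CommRing R] [IsLocalRing R] : Prop where
  noetherian : IsNoetherianRing R
  exists_regular : ∃ rs : List R, (∀ r ∈ rs, r ∈ IsLocalRing.maximalIdeal R) ∧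
    RingTheory.Sequence.IsRegular R rs ∧ (rs.length : WithBot ℕ∞) = ringKrullDim R

/-- A Noetherian ring is Cohen--Macaulay if its localizations at all maximal ideals are. -/
structure IsCohenMacaulayRing (R : Type*) [CommRing R] : Prop where
  noetherian : IsNoetherianRing R
  localization : ∀ (p : Ideal R) [p.IsMaximal],
    IsCohenMacaulayLocalRing (Localization.AtPrime p)

variable {K : Type*} [Field K] {n m : ℕ}

/-- The monomials with exponent vectors `u 0, …, u m` are the minimal monomial generators,
listed without repetition, of the (monomial) ideal `I`: they generate `I`, and none of them
divides another. -/
structure IsMinimalMonomialGenerators (I : Ideal (MvPolynomial (Fin n) K))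
    (u : Fin (m + 1) → (Fin n →₀ ℕ)) : Prop where
  span_eq : I = Ideal.span (Set.range fun i => monomial (u i) (1 : K))
  not_dvd : ∀ i j, i ≠ j → ¬ u i ≤ u j

variable (K) in
/-- The map `φ₁ : ⨁ S eᵢ → S`, `eᵢ ↦ uᵢ`. -/
def generatorMap (u : Fin (m + 1) → (Fin n →₀ ℕ)) :
    (Fin (m + 1) → MvPolynomial (Fin n) K) →ₗ[MvPolynomial (Fin n) K] MvPolynomial (Fin n) K :=
  Fintype.linearCombination (MvPolynomial (Fin n) K) fun i => monomial (u i) (1 : K)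

variable (K) in
/-- The Taylor relation `(uᵢ / gcd(uᵢ, uⱼ)) eⱼ - (uⱼ / gcd(uᵢ, uⱼ)) eᵢ`. On exponent vectors the
gcd is the componentwise minimum and division of monomials is subtraction. -/
def taylorRelation (u : Fin (m + 1) → (Fin n →₀ ℕ)) (i j : Fin (m + 1)) :
    Fin (m + 1) → MvPolynomial (Fin n) K :=
  Pi.single j (monomial (u i - u i ⊓ u j) 1) - Pi.single i (monomial (u j - u i ⊓ u j) 1)

/-- `A` is a Hilbert--Burch matrix of the ideal generated by the monomials `uᵢ`: its rows are
Taylor relations, and `0 → S ^ m → S ^ (m + 1) → S`, with first map `v ↦ v A` and second map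
`φ₁`, is exact and minimal (the entries of `A` lie in the ideal generated by the variables). -/
structure IsHilbertBurchMatrix (u : Fin (m + 1) → (Fin n →₀ ℕ))
    (A : Matrix (Fin m) (Fin (m + 1)) (MvPolynomial (Fin n) K)) : Prop where
  row_taylor : ∀ k, ∃ i j, i < j ∧ A k = taylorRelation K u i j
  injective : Function.Injective A.vecMulLinear
  exact : Function.Exact A.vecMulLinear (generatorMap K u)
  minimal : ∀ k l, A k l ∈ Ideal.span (Set.range (X : Fin n → MvPolynomial (Fin n) K))

/-- The graph of a matrix: `{i, j}` is an edge iff some row has its nonzero entries exactly in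
the positions `i` and `j`. -/
def matrixGraph (A : Matrix (Fin m) (Fin (m + 1)) (MvPolynomial (Fin n) K)) :
    SimpleGraph (Fin (m + 1)) where
  Adj i j := i ≠ j ∧ ∃ k, ∀ l, A k l ≠ 0 ↔ l = i ∨ l = j
  symm := ⟨fun _ _ h => ⟨h.1.symm, h.2.imp fun _ hk l => (hk l).trans or_comm⟩⟩
  loopless := ⟨fun _ h => h.1 rfl⟩

variable (K) in
/-- `𝒯(I)`: the graphs of the Hilbert--Burch matrices of the ideal `I` over `K` with minimal
monomial generators `uᵢ`. -/
def relationTrees (u : Fin (m + 1) → (Fin n →₀ ℕ)) : Set (SimpleGraph (Fin (m + 1))) :=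
  {Γ | ∃ A : Matrix (Fin m) (Fin (m + 1)) (MvPolynomial (Fin n) K),
    IsHilbertBurchMatrix u A ∧ Γ = matrixGraph A}

end RelationTrees

end

/-! Let `Z` be the syzygy module of the generators, `𝔪` the ideal of the variables and `V = Z/𝔪Z`.
Every pair of indices gives a vector of `V`, the class of its Taylor relation. The edge sets of the
relation trees turn out to be the bases of the linear matroid of these vectors; they exist because
every matroid has a base.

Taylor relations are homogeneous for the multigrading and generate `Z`, so a graded Nakayama
argument (`syzygies_le_span_of_le_sup`) shows that a set of edges generates `Z` as soon as its
classes span `V`. By `isHilbertBurchMatrix_iff`, a Hilbert–Burch matrix is merely a choice of `m`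
Taylor relations generating `Z`: injectivity follows because `Z` has rank `m`, minimality because no
generator divides another. For the same reason of rank, every generating set has at least `m`
elements. It remains to see that `dim V ≤ m`, and only this uses the Cohen–Macaulay property and the
height.

The ideal `I` lies in an ideal generated by at most two variables, so `S/I` has dimension at least
`n - 2` at the origin. The inequality `pd + depth ≤ n` over the localization `S_𝔪` then gives
projective dimension at most `2`. Hence `Z_𝔪` is free, of rank `m`, and clearing denominators in a
basis gives `m` syzygies that span `V`.

The graphs are trees because setting all variables to `1` turns Taylor relations into differences
`e_j - e_i`. Generating `Z` thus forces connectedness, and a connected graph with at most `m` edges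
on `m + 1` vertices is a tree. -/

noncomputable section

namespace RelationTrees

/-! ### Multigraded syzygies of monomials -/

section Syzygies

variable {K : Type*} [Field K] {n m : ℕ}

variable (K) in
/-- The syzygy module of the monomials with exponents `u`. -/
abbrev syzygies (u : Fin (m + 1) → (Fin n →₀ ℕ)) :
    Submodule (MvPolynomial (Fin n) K) (Fin (m + 1) → MvPolynomial (Fin n) K) :=
  LinearMap.ker (generatorMap K u)

variable (K) in
/-- The syzygies with coefficients in the irrelevant ideal. -/
abbrev radSyzygies (u : Fin (m + 1) → (Fin n →₀ ℕ)) :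
    Submodule (MvPolynomial (Fin n) K) (Fin (m + 1) → MvPolynomial (Fin n) K) :=
  Ideal.span (Set.range (X : Fin n → MvPolynomial (Fin n) K)) • syzygies K u

lemma generatorMap_single (u : Fin (m + 1) → (Fin n →₀ ℕ)) (i : Fin (m + 1))
    (p : MvPolynomial (Fin n) K) :
    generatorMap K u (Pi.single i p) = p * monomial (u i) 1 := by
  rw [generatorMap, Fintype.linearCombination_apply_single, smul_eq_mul]

lemma taylorRelation_mem_syzygies (u : Fin (m + 1) → (Fin n →₀ ℕ)) (i j : Fin (m + 1)) :
    taylorRelation K u i j ∈ syzygies K u := by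
  rw [LinearMap.mem_ker, taylorRelation, map_sub, generatorMap_single, generatorMap_single,
    monomial_mul, monomial_mul, sub_eq_zero]
  refine congrArg (fun c => monomial c (1 * 1 : K)) (Finsupp.ext fun k => ?_)
  simp only [Finsupp.coe_add, Finsupp.coe_tsub, Pi.add_apply, Pi.sub_apply, Finsupp.inf_apply]
  omega

/-- The component of multidegree `a` of a vector, where the `k`-th basis vector has
multidegree `u k`. -/
def homComponent (u : Fin (m + 1) → (Fin n →₀ ℕ)) (a : Fin n →₀ ℕ) :
    (Fin (m + 1) → MvPolynomial (Fin n) K) →ₗ[K] (Fin (m + 1) → MvPolynomial (Fin n) K) :=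
  LinearMap.pi fun k =>
    if u k ≤ a then (monomial (a - u k) ∘ₗ lcoeff K (a - u k)) ∘ₗ LinearMap.proj k else 0

lemma homComponent_apply (u : Fin (m + 1) → (Fin n →₀ ℕ)) (a : Fin n →₀ ℕ)
    (f : Fin (m + 1) → MvPolynomial (Fin n) K) (k : Fin (m + 1)) :
    homComponent u a f k =
      if u k ≤ a then monomial (a - u k) (coeff (a - u k) (f k)) else 0 := by
  rw [homComponent, LinearMap.pi_apply]
  split_ifs <;> rfl

lemma homComponent_single_monomial (u : Fin (m + 1) → (Fin n →₀ ℕ)) (a c : Fin n →₀ ℕ)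
    (k : Fin (m + 1)) (r : K) :
    homComponent u a (Pi.single k (monomial c r)) =
      if c + u k = a then Pi.single k (monomial c r) else 0 := by
  ext1 l
  rw [homComponent_apply]
  by_cases hl : l = k
  · subst hl
    by_cases h : c + u l = a
    · subst h
      simp
    · rw [if_neg h, Pi.single_eq_same, Pi.zero_apply]
      split_ifs with h'
      · rw [coeff_monomial, if_neg, map_zero]
        rintro rfl
        exact h (tsub_add_cancel_of_le h')
      · rfl
  · have h1 : (Pi.single k (monomial c r) : Fin (m + 1) → MvPolynomial (Fin n) K) l = 0 :=
      Pi.single_eq_of_ne hl _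
    rw [h1]
    split_ifs <;> simp [h1]

lemma monomial_smul_taylorRelation (u : Fin (m + 1) → (Fin n →₀ ℕ)) (b : Fin n →₀ ℕ)
    (i j : Fin (m + 1)) :
    (monomial b (1 : K)) • taylorRelation K u i j =
      Pi.single j (monomial (b + (u i - u i ⊓ u j)) 1) -
        Pi.single i (monomial (b + (u j - u i ⊓ u j)) 1) := by
  rw [taylorRelation, smul_sub, ← Pi.single_smul, ← Pi.single_smul]
  simp [smul_eq_mul, monomial_mul]

/-- Both terms of a Taylor relation have multidegree `u i ⊔ u j`, the exponent of the lcm, so a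
projection to one multidegree keeps or kills the relation as a whole. -/
lemma homComponent_monomial_smul_taylorRelation (u : Fin (m + 1) → (Fin n →₀ ℕ))
    (a b : Fin n →₀ ℕ) (i j : Fin (m + 1)) :
    homComponent u a ((monomial b (1 : K)) • taylorRelation K u i j) =
      if b + u i ⊔ u j = a then (monomial b (1 : K)) • taylorRelation K u i j else 0 := by
  have h1 : b + (u i - u i ⊓ u j) + u j = b + u i ⊔ u j := by
    ext k
    simp only [Finsupp.coe_add, Finsupp.coe_tsub, Pi.add_apply, Pi.sub_apply, Finsupp.inf_apply,
      Finsupp.sup_apply]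
    omega
  have h2 : b + (u j - u i ⊓ u j) + u i = b + u i ⊔ u j := by
    ext k
    simp only [Finsupp.coe_add, Finsupp.coe_tsub, Pi.add_apply, Pi.sub_apply, Finsupp.inf_apply,
      Finsupp.sup_apply]
    omega
  rw [monomial_smul_taylorRelation, map_sub, homComponent_single_monomial,
    homComponent_single_monomial, h1, h2]
  split_ifs <;> simp

lemma exists_sum_homComponent (u : Fin (m + 1) → (Fin n →₀ ℕ))
    (f : Fin (m + 1) → MvPolynomial (Fin n) K) :
    ∃ s : Finset (Fin n →₀ ℕ), f = ∑ a ∈ s, homComponent u a f := by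
  classical
  -- These are the multidegrees of the terms that occur in `f`.
  refine ⟨Finset.univ.biUnion fun k => (f k).support.image (· + u k), ?_⟩
  ext k c
  rw [Finset.sum_apply, coeff_sum, Finset.sum_eq_single (c + u k)]
  · rw [homComponent_apply, if_pos le_add_self, add_tsub_cancel_right, coeff_monomial, if_pos rfl]
  · intro a _ ha
    rw [homComponent_apply]
    split_ifs with h
    · rw [coeff_monomial, if_neg]
      rintro rfl
      exact ha (tsub_add_cancel_of_le h).symm
    · simp
  · intro h
    rw [homComponent_apply, if_pos le_add_self, add_tsub_cancel_right, coeff_monomial, if_pos rfl]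
    by_contra hc
    exact h (Finset.mem_biUnion.2 ⟨k, Finset.mem_univ _,
      Finset.mem_image_of_mem _ (mem_support_iff.2 hc)⟩)

/-- In multidegree `a` a vector has entries `d k * x^(a - u k)`, and for a syzygy the scalars `d k`
sum to `0`. It is therefore a combination of differences against one fixed index `k₀`, and these are
monomial multiples of Taylor relations. -/
lemma homComponent_mem_span_taylorRelation (u : Fin (m + 1) → (Fin n →₀ ℕ)) (a : Fin n →₀ ℕ)
    {f : Fin (m + 1) → MvPolynomial (Fin n) K} (hf : f ∈ syzygies K u) :
    homComponent u a f ∈ Submodule.span (MvPolynomial (Fin n) K)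
      (Set.range (Function.uncurry (taylorRelation K u))) := by
  classical
  set d : Fin (m + 1) → K := fun k => if u k ≤ a then coeff (a - u k) (f k) else 0 with hd
  have hsum : ∑ k, d k = 0 := by
    have h := congrArg (coeff a) (LinearMap.mem_ker.1 hf)
    rw [generatorMap, Fintype.linearCombination_apply, coeff_sum, coeff_zero] at h
    rw [← h]
    refine Finset.sum_congr rfl fun k _ => ?_
    rw [smul_eq_mul, coeff_mul_monomial', mul_one]
  by_cases hk : ∃ k, u k ≤ a
  · obtain ⟨k₀, hk₀⟩ := hk
    have key : homComponent u a f =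
        ∑ k, (C (d k) * monomial (a - u k₀ ⊔ u k) 1) • taylorRelation K u k₀ k := by
      have h1 : ∀ k, (C (d k) * monomial (a - u k₀ ⊔ u k) 1) • taylorRelation K u k₀ k =
          Pi.single k (monomial (a - u k) (d k)) - Pi.single k₀ (monomial (a - u k₀) (d k)) := by
        intro k
        by_cases hk : u k ≤ a
        · have e1 : a - u k₀ ⊔ u k + (u k₀ - u k₀ ⊓ u k) = a - u k := by
            ext l
            have := hk l
            have := hk₀ l
            simp only [Finsupp.coe_add, Finsupp.coe_tsub, Pi.add_apply, Pi.sub_apply,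
              Finsupp.inf_apply, Finsupp.sup_apply]
            omega
          have e2 : a - u k₀ ⊔ u k + (u k - u k₀ ⊓ u k) = a - u k₀ := by
            ext l
            have := hk l
            have := hk₀ l
            simp only [Finsupp.coe_add, Finsupp.coe_tsub, Pi.add_apply, Pi.sub_apply,
              Finsupp.inf_apply, Finsupp.sup_apply]
            omega
          rw [mul_smul, monomial_smul_taylorRelation, e1, e2, smul_sub, ← Pi.single_smul,
            ← Pi.single_smul]
          simp [smul_eq_mul, C_mul_monomial]
        · have : d k = 0 := if_neg hk
          simp [this]
      have h2 : ∑ k, Pi.single (M := fun _ => MvPolynomial (Fin n) K) k₀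
          (monomial (a - u k₀) (d k)) = 0 := by
        have h3 := map_sum ((LinearMap.single K (fun _ => MvPolynomial (Fin n) K) k₀) ∘ₗ
          monomial (a - u k₀)) d Finset.univ
        rw [hsum, map_zero] at h3
        simpa using h3.symm
      rw [Finset.sum_congr rfl fun k _ => h1 k, Finset.sum_sub_distrib, h2, sub_zero]
      ext1 k
      rw [homComponent_apply, Finset.sum_apply, Finset.sum_eq_single k, Pi.single_eq_same]
      · simp only [hd]
        split_ifs <;> simp
      · intro l _ hl
        exact Pi.single_eq_of_ne hl.symm _
      · simp
    rw [key]
    exact Submodule.sum_mem _ fun k _ => Submodule.smul_mem _ _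
      (Submodule.subset_span ⟨(k₀, k), rfl⟩)
  · have : homComponent u a f = 0 := by
      ext1 k
      rw [homComponent_apply, if_neg fun h => hk ⟨k, h⟩, Pi.zero_apply]
    rw [this]
    exact zero_mem _

/-- The syzygies of monomials are generated by the Taylor relations. -/
lemma syzygies_eq_span_taylorRelation (u : Fin (m + 1) → (Fin n →₀ ℕ)) :
    syzygies K u = Submodule.span (MvPolynomial (Fin n) K)
      (Set.range (Function.uncurry (taylorRelation K u))) := by
  refine le_antisymm (fun f hf => ?_) (Submodule.span_le.2 ?_)
  · obtain ⟨s, hs⟩ := exists_sum_homComponent u f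
    rw [hs]
    exact Submodule.sum_mem _ fun a _ => homComponent_mem_span_taylorRelation u a hf
  · rintro _ ⟨p, rfl⟩
    exact taylorRelation_mem_syzygies u p.1 p.2

/-- This reduces `K`-linear arguments about a span over the polynomial ring to monomial multiples of
the generators, which are homogeneous when the generators are. -/
lemma mem_span_monomial_smul {ι : Type*}
    {T : Set (ι → MvPolynomial (Fin n) K)} {x : ι → MvPolynomial (Fin n) K}
    (hx : x ∈ Submodule.span (MvPolynomial (Fin n) K) T) :
    x ∈ Submodule.span K
      {y | ∃ b : Fin n →₀ ℕ, ∃ t ∈ T, y = (monomial b (1 : K)) • t} := by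
  induction hx using Submodule.span_induction with
  | mem x h => exact Submodule.subset_span ⟨0, x, h, by simp⟩
  | zero => exact zero_mem _
  | add x y _ _ hx hy => exact add_mem hx hy
  | smul p x hxT hx =>
    clear hxT
    induction hx using Submodule.span_induction with
    | mem x h =>
      obtain ⟨b, t, ht, rfl⟩ := h
      induction p using MvPolynomial.induction_on' with
      | monomial c r =>
        have : (monomial c r) • (monomial b (1 : K)) • t = r • (monomial (c + b) (1 : K)) • t := by
          rw [smul_smul, monomial_mul, mul_one, ← smul_assoc, smul_monomial, smul_eq_mul, mul_one]
        rw [this]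
        exact Submodule.smul_mem _ _ (Submodule.subset_span ⟨_, t, ht, rfl⟩)
      | add p q hp hq => rw [add_smul]; exact add_mem hp hq
    | zero => rw [smul_zero]; exact zero_mem _
    | add x y _ _ hx hy => rw [smul_add]; exact add_mem hx hy
    | smul r x _ hx => rw [smul_comm]; exact Submodule.smul_mem _ _ hx

lemma mem_radSyzygies_span (u : Fin (m + 1) → (Fin n →₀ ℕ))
    {x : Fin (m + 1) → MvPolynomial (Fin n) K} (hx : x ∈ radSyzygies K u) :
    x ∈ Submodule.span K {y | ∃ b : Fin n →₀ ℕ, b ≠ 0 ∧ ∃ i j,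
      y = (monomial b (1 : K)) • taylorRelation K u i j} := by
  rw [radSyzygies, syzygies_eq_span_taylorRelation, Ideal.span, Submodule.span_smul_span] at hx
  refine Submodule.span_mono ?_ (mem_span_monomial_smul hx)
  rintro _ ⟨b, _, ⟨_, ⟨i, rfl⟩, _, ⟨⟨p, q⟩, rfl⟩, rfl⟩, rfl⟩
  refine ⟨b + Finsupp.single i 1, ?_, p, q, ?_⟩
  · intro h
    simpa using DFunLike.congr_fun h i
  · change monomial b (1 : K) • (X i : MvPolynomial (Fin n) K) • taylorRelation K u p q = _
    rw [smul_smul, X, monomial_mul, mul_one]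

/-- Graded Nakayama lemma: Taylor relations which generate the syzygies modulo the irrelevant ideal
generate them. -/
lemma syzygies_le_span_of_le_sup (u : Fin (m + 1) → (Fin n →₀ ℕ))
    {T : Set (Fin (m + 1) → MvPolynomial (Fin n) K)}
    (hT : T ⊆ Set.range (Function.uncurry (taylorRelation K u)))
    (h : (syzygies K u).restrictScalars K ≤
      Submodule.span K T ⊔ (radSyzygies K u).restrictScalars K) :
    syzygies K u ≤ Submodule.span (MvPolynomial (Fin n) K) T := by
  set W := Submodule.span (MvPolynomial (Fin n) K) T with hW
  -- Well-founded induction on the multidegree `a`: projecting to degree `a` keeps members of `T` or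
  -- kills them, and leaves from the radical part only proper monomial multiples of Taylor relations
  -- of smaller degree.
  have key : ∀ a : Fin n →₀ ℕ, ∀ i j, u i ⊔ u j = a → taylorRelation K u i j ∈ W := by
    intro a
    induction a using WellFoundedLT.induction with
    | ind a ih =>
      intro i j hij
      have hself : homComponent u a (taylorRelation K u i j) = taylorRelation K u i j := by
        have := homComponent_monomial_smul_taylorRelation (K := K) u a 0 i j
        rw [zero_add, if_pos hij] at this
        simpa using this
      obtain ⟨x, hx, y, hy, hxy⟩ := Submodule.mem_sup.1 (h (taylorRelation_mem_syzygies u i j))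
      rw [← hself, ← hxy, map_add]
      refine add_mem ?_ ?_
      · clear hxy
        induction hx using Submodule.span_induction with
        | mem x h =>
          obtain ⟨⟨p, q⟩, hpq⟩ := hT h
          have := homComponent_monomial_smul_taylorRelation (K := K) u a 0 p q
          simp only [Function.uncurry] at hpq
          rw [zero_add, hpq, show monomial 0 (1 : K) = 1 from rfl, one_smul] at this
          rw [this]
          split_ifs
          · exact Submodule.subset_span h
          · exact zero_mem _
        | zero => rw [map_zero]; exact zero_mem _
        | add x y _ _ hx hy => rw [map_add]; exact add_mem hx hy
        | smul r x _ hx => rw [map_smul]; exact Submodule.smul_of_tower_mem W r hx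
      · have hy' := mem_radSyzygies_span u hy
        clear hxy hy
        induction hy' using Submodule.span_induction with
        | mem x h =>
          obtain ⟨b, hb, p, q, rfl⟩ := h
          rw [homComponent_monomial_smul_taylorRelation]
          split_ifs with hpq
          · refine Submodule.smul_mem _ _ (ih _ ?_ p q rfl)
            rw [← hpq]
            exact lt_add_of_pos_left _ (pos_iff_ne_zero.2 hb)
          · exact zero_mem _
        | zero => rw [map_zero]; exact zero_mem _
        | add x y _ _ hx hy => rw [map_add]; exact add_mem hx hy
        | smul r x _ hx => rw [map_smul]; exact Submodule.smul_of_tower_mem W r hx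
  rw [syzygies_eq_span_taylorRelation]
  refine Submodule.span_le.2 ?_
  rintro _ ⟨⟨p, q⟩, rfl⟩
  exact key _ p q rfl

/-- The image is a nonzero ideal of a domain, hence of rank `1`, and rank is additive. -/
lemma finrank_ker_linearCombination {R : Type*} [CommRing R] [IsDomain R] [IsNoetherianRing R]
    (g : Fin (m + 1) → R) (hg : g ≠ 0) :
    Module.finrank R (LinearMap.ker (Fintype.linearCombination R g)) = m := by
  set φ := Fintype.linearCombination R g
  have h1 := Submodule.finrank_quotient_add_finrank (LinearMap.ker φ)
  rw [φ.quotKerEquivRange.finrank_eq, Module.finrank_fin_fun] at h1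
  have h2 : Module.finrank R (LinearMap.range φ) ≤ 1 := by
    simpa using Submodule.finrank_le (LinearMap.range φ)
  have h3 : Module.finrank R (LinearMap.range φ) ≠ 0 := by
    rw [Ne, Submodule.finrank_eq_zero, LinearMap.range_eq_bot]
    intro h
    apply hg
    ext i
    simpa [φ, Fintype.linearCombination_apply_single] using
      LinearMap.congr_fun h (Pi.single i 1)
  omega

lemma finrank_syzygies (u : Fin (m + 1) → (Fin n →₀ ℕ)) :
    Module.finrank (MvPolynomial (Fin n) K) (syzygies K u) = m := by
  refine finrank_ker_linearCombination _ fun h => ?_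
  have := congrFun h 0
  simp at this

/-! ### Hilbert–Burch matrices and their graphs -/

variable (K) in
/-- The Taylor relation of an unordered pair. -/
def edgeRelation (u : Fin (m + 1) → (Fin n →₀ ℕ)) (e : Sym2 (Fin (m + 1))) :
    Fin (m + 1) → MvPolynomial (Fin n) K :=
  taylorRelation K u e.inf e.sup

lemma edgeRelation_mk (u : Fin (m + 1) → (Fin n →₀ ℕ)) {i j : Fin (m + 1)} (h : i ≤ j) :
    edgeRelation K u s(i, j) = taylorRelation K u i j := by
  rw [edgeRelation, Sym2.inf_mk, Sym2.sup_mk, inf_eq_left.2 h, sup_eq_right.2 h]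

lemma exists_mk_of_not_isDiag {e : Sym2 (Fin (m + 1))} (he : ¬ e.IsDiag) :
    ∃ i j, i < j ∧ e = s(i, j) := by
  induction e using Sym2.ind with
  | _ i j =>
    rcases lt_trichotomy i j with h | rfl | h
    · exact ⟨i, j, h, rfl⟩
    · simp at he
    · exact ⟨j, i, h, Sym2.eq_swap⟩

lemma taylorRelation_swap (u : Fin (m + 1) → (Fin n →₀ ℕ)) (i j : Fin (m + 1)) :
    taylorRelation K u i j = -taylorRelation K u j i := by
  rw [taylorRelation, taylorRelation, inf_comm, neg_sub]

lemma taylorRelation_self (u : Fin (m + 1) → (Fin n →₀ ℕ)) (i : Fin (m + 1)) :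
    taylorRelation K u i i = 0 := by
  rw [taylorRelation, sub_self]

lemma taylorRelation_ne_zero_iff (u : Fin (m + 1) → (Fin n →₀ ℕ)) {i j : Fin (m + 1)}
    (h : i ≠ j) (l : Fin (m + 1)) : taylorRelation K u i j l ≠ 0 ↔ l = i ∨ l = j := by
  rw [taylorRelation, Pi.sub_apply]
  by_cases hi : l = i
  · subst hi
    simp [Pi.single_eq_of_ne h]
  · by_cases hj : l = j
    · subst hj
      simp [Pi.single_eq_of_ne hi]
    · simp [hi, hj]

lemma edgeRelation_ne_zero_iff (u : Fin (m + 1) → (Fin n →₀ ℕ)) {e : Sym2 (Fin (m + 1))}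
    (he : ¬ e.IsDiag) (l : Fin (m + 1)) : edgeRelation K u e l ≠ 0 ↔ l ∈ e := by
  obtain ⟨i, j, hij, rfl⟩ := exists_mk_of_not_isDiag he
  rw [edgeRelation_mk u hij.le, taylorRelation_ne_zero_iff u hij.ne, Sym2.mem_iff]

lemma edgeRelation_mem_syzygies (u : Fin (m + 1) → (Fin n →₀ ℕ)) (e : Sym2 (Fin (m + 1))) :
    edgeRelation K u e ∈ syzygies K u :=
  taylorRelation_mem_syzygies u _ _

lemma edgeSet_matrixGraph (u : Fin (m + 1) → (Fin n →₀ ℕ))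
    {A : Matrix (Fin m) (Fin (m + 1)) (MvPolynomial (Fin n) K)}
    {p : Fin m → Sym2 (Fin (m + 1))} (hp : ∀ k, ¬ (p k).IsDiag)
    (hA : ∀ k, A k = edgeRelation K u (p k)) :
    (matrixGraph A).edgeSet = Set.range p := by
  ext e
  induction e using Sym2.ind with
  | _ i j =>
    rw [SimpleGraph.mem_edgeSet]
    constructor
    · rintro ⟨hij, k, hk⟩
      refine ⟨k, Sym2.ext fun l => ?_⟩
      rw [← edgeRelation_ne_zero_iff (K := K) u (hp k), ← hA, hk, Sym2.mem_iff]
    · rintro ⟨k, hk⟩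
      refine ⟨fun h => hp k ?_, k, fun l => ?_⟩
      · rw [hk, h]
        exact Sym2.mk_isDiag_iff.2 rfl
      · rw [hA, edgeRelation_ne_zero_iff u (hp k), hk, Sym2.mem_iff]

/-- Source and image both have rank `m`, so the kernel has rank `0`; being a submodule of a free
module over a domain, it vanishes. -/
lemma injective_vecMulLinear_of_range_eq (u : Fin (m + 1) → (Fin n →₀ ℕ))
    {A : Matrix (Fin m) (Fin (m + 1)) (MvPolynomial (Fin n) K)}
    (hA : LinearMap.range A.vecMulLinear = syzygies K u) :
    Function.Injective A.vecMulLinear := by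
  have h1 := Submodule.finrank_quotient_add_finrank (LinearMap.ker A.vecMulLinear)
  rw [A.vecMulLinear.quotKerEquivRange.finrank_eq, Module.finrank_fin_fun, hA,
    finrank_syzygies] at h1
  rw [← LinearMap.ker_eq_bot, ← Submodule.finrank_eq_zero
    (R := MvPolynomial (Fin n) K)]
  omega

lemma monomial_mem_span_X {b : Fin n →₀ ℕ} (hb : b ≠ 0) (r : K) :
    monomial b r ∈ Ideal.span (Set.range (X : Fin n → MvPolynomial (Fin n) K)) := by
  obtain ⟨i, hi⟩ := Finsupp.ne_iff.1 hb
  have : monomial b r = monomial (b - Finsupp.single i 1) r * X i := by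
    rw [X, monomial_mul, mul_one, tsub_add_cancel_of_le]
    rw [Finsupp.single_le_iff]
    exact Nat.one_le_iff_ne_zero.2 hi
  rw [this]
  exact Ideal.mul_mem_left _ _ (Ideal.subset_span ⟨i, rfl⟩)

lemma taylorRelation_mem_span_X {u : Fin (m + 1) → (Fin n →₀ ℕ)}
    (hu : ∀ i j, i ≠ j → ¬ u i ≤ u j) (i j l : Fin (m + 1)) :
    taylorRelation K u i j l ∈
      Ideal.span (Set.range (X : Fin n → MvPolynomial (Fin n) K)) := by
  by_cases hij : i = j
  · subst hij
    rw [taylorRelation_self]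
    exact zero_mem _
  have h1 : ∀ (k : Fin (m + 1)) (b : Fin n →₀ ℕ), b ≠ 0 →
      (Pi.single k (monomial b 1) : Fin (m + 1) → MvPolynomial (Fin n) K) l ∈
      Ideal.span (Set.range (X : Fin n → MvPolynomial (Fin n) K)) := by
    intro k b hb
    by_cases hl : l = k
    · subst hl
      rw [Pi.single_eq_same]
      exact monomial_mem_span_X hb 1
    · rw [Pi.single_eq_of_ne hl]
      exact zero_mem _
  refine sub_mem (h1 _ _ fun h => ?_) (h1 _ _ fun h => ?_)
  · exact hu i j hij ((tsub_eq_zero_iff_le.1 h).trans inf_le_right)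
  · exact hu j i (Ne.symm hij) ((tsub_eq_zero_iff_le.1 h).trans inf_le_left)

/-- Among the conditions on a matrix of Taylor relations only generation has content. Injectivity
follows by rank, and minimality because no generator divides another. -/
lemma isHilbertBurchMatrix_iff {u : Fin (m + 1) → (Fin n →₀ ℕ)}
    (hu : ∀ i j, i ≠ j → ¬ u i ≤ u j)
    {A : Matrix (Fin m) (Fin (m + 1)) (MvPolynomial (Fin n) K)} :
    IsHilbertBurchMatrix u A ↔ ∃ p : Fin m → Sym2 (Fin (m + 1)), (∀ k, ¬ (p k).IsDiag) ∧
      (∀ k, A k = edgeRelation K u (p k)) ∧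
      syzygies K u ≤ Submodule.span (MvPolynomial (Fin n) K)
        (edgeRelation K u '' Set.range p) := by
  constructor
  · intro h
    choose i j hij hA using h.row_taylor
    have hA' : ∀ k, A k = edgeRelation K u s(i k, j k) := fun k => by
      rw [hA, edgeRelation_mk u (hij k).le]
    refine ⟨fun k => s(i k, j k), fun k => ?_, hA', ?_⟩
    · rw [Sym2.mk_isDiag_iff]
      exact (hij k).ne
    · rw [syzygies, LinearMap.exact_iff.1 h.exact, range_vecMulLinear, ← Set.range_comp]
      exact Submodule.span_mono (Set.range_subset_range_iff_exists_comp.2 ⟨id, funext hA'⟩)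
  · rintro ⟨p, hp, hA, hspan⟩
    have hr : LinearMap.range A.vecMulLinear = syzygies K u := by
      rw [range_vecMulLinear]
      refine le_antisymm (Submodule.span_le.2 ?_) (hspan.trans (Submodule.span_mono ?_))
      · rintro _ ⟨k, rfl⟩
        change A k ∈ _
        rw [hA]
        exact edgeRelation_mem_syzygies u _
      · rintro _ ⟨_, ⟨k, rfl⟩, rfl⟩
        exact ⟨k, hA k⟩
    refine ⟨fun k => ?_, injective_vecMulLinear_of_range_eq u hr,
      LinearMap.exact_iff.2 hr.symm, fun k l => ?_⟩
    · obtain ⟨i, j, hij, h⟩ := exists_mk_of_not_isDiag (hp k)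
      exact ⟨i, j, hij, by rw [hA, h, edgeRelation_mk u hij.le]⟩
    · rw [hA]
      exact taylorRelation_mem_span_X hu _ _ l

/-- Set all variables to `1` and add the coordinates over the component of `a`. This kills the
relations of all edges, hence all syzygies, but not the Taylor relation of `a` and a vertex `b`
outside the component. -/
lemma connected_of_syzygies_le_span (u : Fin (m + 1) → (Fin n →₀ ℕ))
    (Γ : SimpleGraph (Fin (m + 1)))
    (h : syzygies K u ≤ Submodule.span (MvPolynomial (Fin n) K) (edgeRelation K u '' Γ.edgeSet)) :
    Γ.Connected := by
  classical
  refine ⟨fun a b => ?_⟩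
  by_contra hab
  set L : (Fin (m + 1) → MvPolynomial (Fin n) K) → K := fun f =>
    ∑ l, if Γ.Reachable a l then eval 1 (f l) else 0 with hL
  have hT : ∀ i j, L (taylorRelation K u i j) =
      (if Γ.Reachable a j then 1 else 0) - (if Γ.Reachable a i then 1 else 0) := by
    intro i j
    have h1 : ∀ k c, L (Pi.single k (monomial c 1)) = if Γ.Reachable a k then 1 else 0 := by
      intro k c
      rw [hL]
      dsimp only
      rw [Finset.sum_eq_single k]
      · simp [eval_monomial]
      · intro l _ hl
        simp [Pi.single_eq_of_ne hl]
      · simp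
    have h2 : ∀ f g, L (f - g) = L f - L g := by
      intro f g
      simp only [hL, ← Finset.sum_sub_distrib]
      refine Finset.sum_congr rfl fun l _ => ?_
      split_ifs <;> simp
    rw [taylorRelation, h2, h1, h1]
  have hzero : ∀ f ∈ syzygies K u, L f = 0 := by
    intro f hf
    have hf' := h hf
    clear hf
    induction hf' using Submodule.span_induction with
    | mem x hx =>
      obtain ⟨e, he, rfl⟩ := hx
      obtain ⟨i, j, hij, rfl⟩ := exists_mk_of_not_isDiag (Γ.not_isDiag_of_mem_edgeSet he)
      rw [SimpleGraph.mem_edgeSet] at he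
      have : Γ.Reachable a i ↔ Γ.Reachable a j :=
        ⟨fun h => h.trans he.reachable, fun h => h.trans he.symm.reachable⟩
      rw [edgeRelation_mk u hij.le, hT]
      simp [this]
    | zero => simp [hL]
    | add x y _ _ hx hy =>
      have : L (x + y) = L x + L y := by
        simp only [hL, ← Finset.sum_add_distrib]
        refine Finset.sum_congr rfl fun l _ => ?_
        split_ifs <;> simp
      rw [this, hx, hy, add_zero]
    | smul p x _ hx =>
      have : L (p • x) = eval 1 p * L x := by
        simp only [hL, Finset.mul_sum]
        refine Finset.sum_congr rfl fun l _ => ?_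
        split_ifs <;> simp
      rw [this, hx, mul_zero]
  have := hzero _ (taylorRelation_mem_syzygies u a b)
  rw [hT, if_neg hab, if_pos (SimpleGraph.Reachable.refl a)] at this
  simp at this

/-- There are at most `m` edges, one for each row, and connectedness on `m + 1` vertices needs at
least `m`. -/
lemma isTree_of_mem_relationTrees {u : Fin (m + 1) → (Fin n →₀ ℕ)}
    (hu : ∀ i j, i ≠ j → ¬ u i ≤ u j) {Γ : SimpleGraph (Fin (m + 1))}
    (hΓ : Γ ∈ relationTrees K u) : Γ.IsTree := by
  obtain ⟨A, hA, rfl⟩ := hΓ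
  obtain ⟨p, hp, hpA, hspan⟩ := (isHilbertBurchMatrix_iff hu).1 hA
  have he := edgeSet_matrixGraph u hp hpA
  have hc : (matrixGraph A).Connected := connected_of_syzygies_le_span u _ (by rwa [he])
  rw [SimpleGraph.isTree_iff_connected_and_card]
  refine ⟨hc, ?_⟩
  have h1 := hc.card_vert_le_card_edgeSet_add_one
  have h2 : Nat.card (Set.range p) ≤ m := by
    simpa using Finite.card_range_le p
  rw [he, Nat.card_fin] at *
  omega

/-! ### The matroid of Taylor relations modulo the irrelevant ideal -/

/-- The linear matroid of a finite family of vectors. -/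
lemma exists_matroid_isBase_iff_linearIndepOn {α V : Type*} [AddCommGroup V] [Module K V]
    (w : α → V) {E : Set α} (hE : E.Finite) :
    ∃ M : Matroid α, M.E = E ∧ ∀ B, M.IsBase B ↔
      B ⊆ E ∧ LinearIndepOn K w B ∧ w '' E ⊆ Submodule.span K (w '' B) := by
  have haug : ∀ ⦃I J : Set α⦄, I ⊆ E ∧ LinearIndepOn K w I → J ⊆ E ∧ LinearIndepOn K w J →
      I.ncard < J.ncard → ∃ e ∈ J, e ∉ I ∧ insert e I ⊆ E ∧ LinearIndepOn K w (insert e I) := by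
    intro I J hI hJ hlt
    by_contra! h
    -- If no element of `J` augments `I`, the vectors of `J` lie in the span of those of `I`,
    -- against the dimension count.
    have hspan : w '' J ⊆ Submodule.span K (w '' I) := by
      rintro _ ⟨e, he, rfl⟩
      by_contra hn
      obtain ⟨h1, h2⟩ := hI.2.notMem_span_iff.1 hn
      exact h e he h2 (Set.insert_subset (hJ.1 he) hI.1) h1
    have : Finite I := hE.subset hI.1
    have : Finite J := hE.subset hJ.1
    have := Fintype.ofFinite I
    have := Fintype.ofFinite J
    have hfin : (w '' I).Finite := (hE.subset hI.1).image w
    have : Module.Finite K (Submodule.span K (w '' I)) :=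
      Module.Finite.span_of_finite K hfin
    have h1 : Module.finrank K (Submodule.span K (w '' J)) = J.ncard := by
      rw [Set.image_eq_range, finrank_span_eq_card hJ.2, ← Nat.card_eq_fintype_card,
        Nat.card_coe_set_eq]
    have h2 : Module.finrank K (Submodule.span K (w '' I)) = I.ncard := by
      rw [Set.image_eq_range, finrank_span_eq_card hI.2, ← Nat.card_eq_fintype_card,
        Nat.card_coe_set_eq]
    have h3 := Submodule.finrank_mono (Submodule.span_le.2 hspan)
    omega
  refine ⟨(IndepMatroid.ofFinite hE (fun I => I ⊆ E ∧ LinearIndepOn K w I)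
    ⟨Set.empty_subset _, linearIndepOn_empty K w⟩
    (fun I J hJ hIJ => ⟨hIJ.trans hJ.1, hJ.2.mono hIJ⟩) haug (fun I hI => hI.1)).matroid,
    rfl, fun B => ?_⟩
  rw [Matroid.isBase_iff_maximal_indep]
  change Maximal (fun I => I ⊆ E ∧ LinearIndepOn K w I) B ↔ _
  constructor
  · rintro ⟨⟨hB, hli⟩, hmax⟩
    refine ⟨hB, hli, ?_⟩
    rintro _ ⟨e, he, rfl⟩
    by_contra hn
    obtain ⟨h1, h2⟩ := hli.notMem_span_iff.1 hn
    exact h2 (hmax ⟨Set.insert_subset he hB, h1⟩ (Set.subset_insert e B) (Set.mem_insert e B))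
  · rintro ⟨hB, hli, hspan⟩
    refine ⟨⟨hB, hli⟩, fun J hJ hBJ e he => ?_⟩
    by_contra hn
    have h1 : w e ∉ Submodule.span K (w '' B) :=
      hli.notMem_span_iff.2 ⟨hJ.2.mono (Set.insert_subset he hBJ), hn⟩
    exact h1 (hspan ⟨e, hJ.1 he, rfl⟩)

/-- Multiples of a syzygy by monomials other than `1` already lie in `radSyzygies`, so only scalar
multiples matter. -/
lemma span_le_sup_radSyzygies (u : Fin (m + 1) → (Fin n →₀ ℕ))
    {T : Set (Fin (m + 1) → MvPolynomial (Fin n) K)} (hT : T ⊆ syzygies K u) :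
    (Submodule.span (MvPolynomial (Fin n) K) T).restrictScalars K ≤
      Submodule.span K T ⊔ (radSyzygies K u).restrictScalars K := by
  intro x hx
  refine Submodule.span_le.2 ?_ (mem_span_monomial_smul hx)
  rintro _ ⟨b, t, ht, rfl⟩
  by_cases hb : b = 0
  · subst hb
    rw [show monomial 0 (1 : K) = 1 from rfl, one_smul]
    exact Submodule.mem_sup_left (Submodule.subset_span ht)
  · have ht' : t ∈ syzygies K u := hT ht
    have h : (monomial b (1 : K)) • t ∈ radSyzygies K u :=
      Submodule.smul_mem_smul (monomial_mem_span_X hb 1) ht'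
    exact Submodule.mem_sup_right h

lemma syzygies_le_span_edgeRelation (u : Fin (m + 1) → (Fin n →₀ ℕ)) :
    (syzygies K u).restrictScalars K ≤
      Submodule.span K (edgeRelation K u '' {e | ¬ e.IsDiag}) ⊔
        (radSyzygies K u).restrictScalars K := by
  have h1 : (syzygies K u).restrictScalars K ≤ _ :=
    (Submodule.restrictScalars_mono K (syzygies_eq_span_taylorRelation (K := K) u).le).trans
      (span_le_sup_radSyzygies u ?_)
  · refine h1.trans (sup_le_sup_right (Submodule.span_le.2 ?_) _)
    rintro _ ⟨⟨i, j⟩, rfl⟩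
    simp only [Function.uncurry]
    rcases lt_trichotomy i j with h | rfl | h
    · exact Submodule.subset_span ⟨s(i, j), by simpa using h.ne, edgeRelation_mk u h.le⟩
    · rw [taylorRelation_self]
      exact zero_mem _
    · rw [taylorRelation_swap]
      exact neg_mem (Submodule.subset_span ⟨s(j, i), by simpa using h.ne, edgeRelation_mk u h.le⟩)
  · rintro _ ⟨p, rfl⟩
    exact taylorRelation_mem_syzygies u _ _

/-- If the syzygies are generated by `m` elements modulo the irrelevant ideal, then the edge sets
of the relation trees are the bases of a matroid. -/
lemma exists_matroid_of_syzygies_le {u : Fin (m + 1) → (Fin n →₀ ℕ)}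
    (hu : ∀ i j, i ≠ j → ¬ u i ≤ u j) (g : Fin m → (Fin (m + 1) → MvPolynomial (Fin n) K))
    (hg : (syzygies K u).restrictScalars K ≤
      Submodule.span K (Set.range g) ⊔ (radSyzygies K u).restrictScalars K) :
    ∃ M : Matroid (Sym2 (Fin (m + 1))),
      M.E = (⊤ : SimpleGraph (Fin (m + 1))).edgeSet ∧
      ∀ B : Set (Sym2 (Fin (m + 1))),
        M.IsBase B ↔ ∃ Γ ∈ relationTrees K u, Γ.edgeSet = B := by
  set N := (radSyzygies K u).restrictScalars K with hN
  -- The quotient is that of the whole free module; the classes of the edges span the subspace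
  -- `Z/𝔪Z`.
  set w : Sym2 (Fin (m + 1)) → _ := fun e => N.mkQ (edgeRelation K u e) with hw
  set E : Set (Sym2 (Fin (m + 1))) := {e | ¬ e.IsDiag} with hE
  obtain ⟨M, hME, hM⟩ := exists_matroid_isBase_iff_linearIndepOn (K := K) w (Set.toFinite E)
  have hspan : ∀ B, w '' E ⊆ Submodule.span K (w '' B) ↔
      (syzygies K u).restrictScalars K ≤ Submodule.span K (edgeRelation K u '' B) ⊔ N := by
    intro B
    have h1 : ∀ B, Submodule.span K (w '' B) =
        (Submodule.span K (edgeRelation K u '' B)).map N.mkQ := by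
      intro B
      rw [Submodule.map_span, Set.image_image]
    have h2 : w '' E ⊆ Submodule.span K (w '' B) ↔
        Submodule.span K (edgeRelation K u '' E) ≤ Submodule.span K (edgeRelation K u '' B) ⊔ N := by
      rw [← Submodule.span_le, h1, h1, Submodule.map_le_iff_le_comap, Submodule.comap_map_mkQ,
        sup_comm]
    rw [h2]
    constructor
    · intro h
      exact (syzygies_le_span_edgeRelation u).trans (sup_le h le_sup_right)
    · intro h
      refine (Submodule.span_le.2 ?_).trans h
      rintro _ ⟨e, _, rfl⟩
      exact edgeRelation_mem_syzygies u e
  -- Nakayama turns spanning into generation, and a module of rank `m` needs at least `m`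
  -- generators.
  have hgen : ∀ B, w '' E ⊆ Submodule.span K (w '' B) →
      syzygies K u ≤ Submodule.span (MvPolynomial (Fin n) K) (edgeRelation K u '' B) ∧
      m ≤ B.ncard := by
    intro B hB
    have h1 := syzygies_le_span_of_le_sup u (T := edgeRelation K u '' B)
      (by rintro _ ⟨e, _, rfl⟩; exact ⟨(_, _), rfl⟩) ((hspan B).1 hB)
    refine ⟨h1, ?_⟩
    have h2 : syzygies K u = Submodule.span (MvPolynomial (Fin n) K) (edgeRelation K u '' B) := by
      refine le_antisymm h1 (Submodule.span_le.2 ?_)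
      rintro _ ⟨e, _, rfl⟩
      exact edgeRelation_mem_syzygies u e
    have h3 := finrank_syzygies (K := K) u
    have hfin : (edgeRelation K u '' B).Finite := (Set.toFinite B).image _
    have := hfin.fintype
    rw [h2] at h3
    refine h3.symm.le.trans ((finrank_span_le_card _).trans ?_)
    rw [← Set.ncard_eq_toFinset_card']
    exact Set.ncard_image_le
  -- The classes of the `m` elements `g` span a space that contains all the vectors `w e`.
  have hle : ∀ B, LinearIndepOn K w B → B.ncard ≤ m := by
    intro B hB
    have := Fintype.ofFinite B
    have h1 : Module.finrank K (Submodule.span K (w '' B)) = B.ncard := by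
      rw [Set.image_eq_range, finrank_span_eq_card hB, ← Nat.card_eq_fintype_card,
        Nat.card_coe_set_eq]
    have h2 : Submodule.span K (w '' B) ≤ Submodule.span K (Set.range (N.mkQ ∘ g)) := by
      rw [Submodule.span_le]
      rintro _ ⟨e, _, rfl⟩
      have := hg (edgeRelation_mem_syzygies u e)
      rw [← sup_comm, ← Submodule.comap_map_mkQ, Submodule.map_span, ← Set.range_comp] at this
      exact this
    have : Module.Finite K (Submodule.span K (Set.range (N.mkQ ∘ g))) :=
      Module.Finite.span_of_finite K (Set.finite_range _)
    rw [← h1]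
    refine (Submodule.finrank_mono h2).trans ((finrank_range_le_card _).trans ?_)
    simp
  refine ⟨M, ?_, fun B => ?_⟩
  · rw [hME]
    ext e
    simp [hE, SimpleGraph.edgeSet_top]
  · rw [hM]
    constructor
    · rintro ⟨hBE, hli, hB⟩
      have hcard : Nat.card B = Nat.card (Fin m) := by
        rw [Nat.card_fin, Nat.card_coe_set_eq]
        exact le_antisymm (hle B hli) (hgen B hB).2
      obtain ⟨f⟩ := (Finite.card_eq (α := Fin m) (β := B)).1 hcard.symm
      have hr : Set.range (fun k => (f k : Sym2 (Fin (m + 1)))) = B := by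
        rw [show (fun k => (f k : Sym2 (Fin (m + 1)))) = Subtype.val ∘ f from rfl,
          f.surjective.range_comp, Subtype.range_coe]
      have hp : ∀ k, ¬ (f k : Sym2 (Fin (m + 1))).IsDiag := fun k => hBE (f k).2
      refine ⟨_, ⟨fun k => edgeRelation K u (f k), (isHilbertBurchMatrix_iff hu).2
        ⟨fun k => f k, hp, fun k => rfl, ?_⟩, rfl⟩, ?_⟩
      · rw [hr]
        exact (hgen B hB).1
      · rw [edgeSet_matrixGraph u hp fun _ => rfl, hr]
    · rintro ⟨_, ⟨A, hA, rfl⟩, rfl⟩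
      obtain ⟨p, hp, hpA, hsp⟩ := (isHilbertBurchMatrix_iff hu).1 hA
      rw [edgeSet_matrixGraph u hp hpA]
      have hBE : Set.range p ⊆ E := by
        rintro _ ⟨k, rfl⟩
        exact hp k
      have hB : w '' E ⊆ Submodule.span K (w '' Set.range p) := by
        rw [hspan]
        refine (Submodule.restrictScalars_mono K hsp).trans (span_le_sup_radSyzygies u ?_)
        rintro _ ⟨e, _, rfl⟩
        exact edgeRelation_mem_syzygies u e
      refine ⟨hBE, ?_, hB⟩
      -- An independent subset `B` of the rows with the same span still generates the syzygies, so
      -- it has at least `m` elements and must be all of `Set.range p`.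
      obtain ⟨B, hBp, -, hBs, hBi⟩ := exists_linearIndepOn_extension
        (linearIndepOn_empty K w) (Set.empty_subset (Set.range p))
      have h1 := (hgen B (hB.trans (Submodule.span_le.2 hBs))).2
      have h2 : (Set.range p).ncard ≤ m := by
        rw [← Nat.card_coe_set_eq]
        simpa using Finite.card_range_le p
      rwa [← Set.eq_of_subset_of_ncard_le hBp (h2.trans h1)]

end Syzygies

/-! ### Projective dimension over a local ring with maximal ideal generated by a regular sequence -/

section LocalRing

open CategoryTheory IsLocalRing RingTheory.Sequence

universe u

variable {R : Type u} [CommRing R] [IsLocalRing R] [IsNoetherianRing R]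

/-- If the maximal ideal is generated by a regular sequence `xs`, modules of finite length have
projective dimension at most the length of `xs`. -/
lemma hasProjectiveDimensionLE_of_pow_smul_eq_zero {xs : List R} (hxs : IsRegular R xs)
    (hmax : Ideal.ofList xs = maximalIdeal R) (k : ℕ) (N : Type u) [AddCommGroup N] [Module R N]
    [Module.Finite R N] (hN : ∀ r ∈ maximalIdeal R ^ k, ∀ x : N, r • x = 0) :
    HasProjectiveDimensionLE (ModuleCat.of R N) xs.length := by
  revert hN
  -- Dévissage to quotients `R ⧸ p` with `p` prime. Annihilation by a power of the maximal ideal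
  -- forces `p` to be maximal, and the residue field is the quotient by the regular sequence `xs`.
  refine IsNoetherianRing.induction_on_isQuotientEquivQuotientPrime R (M := N) inferInstance
    (motive := fun N _ _ _ => (∀ r ∈ maximalIdeal R ^ k, ∀ x : N, r • x = 0) →
      HasProjectiveDimensionLE (ModuleCat.of R N) xs.length) ?_ ?_ ?_
  · intro N _ _ _ _ _
    have := (ModuleCat.isZero_of_subsingleton (ModuleCat.of R N)).hasProjectiveDimensionLT_zero
    exact hasProjectiveDimensionLT_of_ge _ 0 _ (Nat.zero_le _)
  · intro N _ _ _ p e hN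
    have hp : maximalIdeal R = p.1 := by
      refine le_antisymm (Ideal.IsPrime.le_of_pow_le (n := k) fun r hr => ?_)
        (le_maximalIdeal p.2.ne_top)
      have := hN r hr (e.symm 1)
      rwa [← map_smul, e.symm.map_eq_zero_iff, Algebra.smul_def, mul_one,
        Ideal.Quotient.algebraMap_eq, Ideal.Quotient.eq_zero_iff_mem] at this
    have h1 := ModuleCat.projectiveDimension_quotient_eq_length.{u} xs hxs
    have h2 : HasProjectiveDimensionLE (ModuleCat.of R (Shrink.{u} (R ⧸ Ideal.ofList xs)))
        xs.length := (projectiveDimension_le_iff _ _).1 h1.le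
    have e' : Shrink.{u} (R ⧸ Ideal.ofList xs) ≃ₗ[R] N :=
      (Shrink.linearEquiv R _).trans
        ((Submodule.quotEquivOfEq _ _ (hmax.trans hp)).trans e.symm)
    exact hasProjectiveDimensionLT_of_iso e'.toModuleIso _
  · intro N₁ _ _ _ N₂ _ _ _ N₃ _ _ _ f g hf hg hfg h₁ h₃ hN
    have h1 := h₁ fun r hr x => hf (by rw [map_smul, hN r hr, map_zero])
    have h3 := h₃ fun r hr x => by
      obtain ⟨y, rfl⟩ := hg x
      rw [← map_smul, hN r hr, map_zero]
    have hS : (ShortComplex.mk (ModuleCat.ofHom f) (ModuleCat.ofHom g)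
        (by ext x; exact hfg.apply_apply_eq_zero x)).ShortExact :=
      { exact := by
          rw [ShortComplex.ShortExact.moduleCat_exact_iff_function_exact]
          exact hfg
        mono_f := (ModuleCat.mono_iff_injective _).2 hf
        epi_g := (ModuleCat.epi_iff_surjective _).2 hg }
    exact hS.hasProjectiveDimensionLT_X₂ _ h1 h3

/-- The inequality `pd M + depth M ≤ n` of the Auslander-Buchsbaum formula for a finite module which
has finite length modulo a regular sequence, when the maximal ideal is generated by a regular
sequence of length `n`. -/
lemma projectiveDimension_add_length_le {xs : List R} (hxs : IsRegular R xs)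
    (hmax : Ideal.ofList xs = maximalIdeal R) (M : Type u) [AddCommGroup M] [Module R M]
    [Module.Finite R M] [Nontrivial M] {rs : List R} (hrs : IsWeaklyRegular M rs)
    (hmem : ∀ r ∈ rs, r ∈ maximalIdeal R) (k : ℕ)
    (hk : ∀ r ∈ maximalIdeal R ^ k, ∀ x : M, r • x ∈ Ideal.ofList rs • (⊤ : Submodule R M)) :
    projectiveDimension (ModuleCat.of R M) + rs.length ≤ xs.length := by
  -- Each element of the regular sequence raises the projective dimension of the quotient by one, so
  -- the left side is the projective dimension of `M` modulo `rs`.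
  rw [← ModuleCat.projectiveDimension_quotient_eq_add_length_of_isWeaklyRegular
    (ModuleCat.of R M) rs hrs hmem, projectiveDimension_le_iff]
  refine hasProjectiveDimensionLE_of_pow_smul_eq_zero hxs hmax k
    (M ⧸ Ideal.ofList rs • (⊤ : Submodule R M)) fun r hr x => ?_
  obtain ⟨x, rfl⟩ := Submodule.Quotient.mk_surjective _ x
  rw [← Submodule.Quotient.mk_smul, Submodule.Quotient.mk_eq_zero]
  exact hk r hr x

/-- The second syzygy module of a cyclic module of projective dimension at most two is free. -/
lemma free_ker_linearCombination (M : Type u) [AddCommGroup M] [Module R M]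
    [HasProjectiveDimensionLE (ModuleCat.of R M) 2] {q : R →ₗ[R] M} (hq : Function.Surjective q)
    {ι : Type} [Fintype ι] (g : ι → R) (hg : LinearMap.ker q = Ideal.span (Set.range g)) :
    Module.Free R (LinearMap.ker (Fintype.linearCombination R g)) := by
  set φ := Fintype.linearCombination R g with hφ
  have hr : LinearMap.range φ = LinearMap.ker q := by
    rw [hg, hφ, Fintype.range_linearCombination]
  let φ' : (ι → R) →ₗ[R] LinearMap.ker q := φ.codRestrict _ fun x => hr ▸ ⟨x, rfl⟩
  have hφ' : Function.Surjective φ' := by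
    rintro ⟨y, hy⟩
    rw [← hr] at hy
    obtain ⟨x, rfl⟩ := hy
    exact ⟨x, rfl⟩
  -- Dimension shifting along `0 → ker q → R → M → 0` and `0 → ker φ → R^ι → ker q → 0`: each
  -- projective middle term lowers the bound by one, which leaves a projective kernel.
  have hS₁ := LinearMap.shortExact_shortComplexKer hq
  have hS₂ := LinearMap.shortExact_shortComplexKer hφ'
  have p1 : Projective (ModuleCat.of R R) :=
    (ModuleCat.of R R).projective_of_categoryTheory_projective
  have p2 : Projective (ModuleCat.of R (ι → R)) := inferInstance
  have h1 := (hS₁.hasProjectiveDimensionLT_X₃_iff 1 p1).1 ‹_›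
  have h2 := (hS₂.hasProjectiveDimensionLT_X₃_iff 0 p2).1 h1
  rw [← projective_iff_hasProjectiveDimensionLT_one, ← IsProjective.iff_projective] at h2
  have hker : LinearMap.ker φ' = LinearMap.ker φ := LinearMap.ker_codRestrict _ _ _
  have h3 : Module.Projective R (LinearMap.ker φ') := h2
  rw [hker] at h3
  exact Module.free_of_flat_of_isLocalRing

/-- The second syzygy module of a Cohen-Macaulay quotient of codimension at most two is free. -/
lemma free_ker_linearCombination_of_isCohenMacaulayLocalRing {xs : List R} (hxs : IsRegular R xs)
    (hmax : Ideal.ofList xs = maximalIdeal R) {A : Type u} [CommRing A] [IsLocalRing A]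
    (hA : IsCohenMacaulayLocalRing A) {ψ : R →+* A} (hψ : Function.Surjective ψ) {d : ℕ}
    (hd : (d : WithBot ℕ∞) ≤ ringKrullDim A) (hxd : xs.length ≤ d + 2)
    {ι : Type} [Fintype ι] (g : ι → R) (hg : RingHom.ker ψ = Ideal.span (Set.range g)) :
    Module.Free R (LinearMap.ker (Fintype.linearCombination R g)) := by
  let _ : Algebra R A := ψ.toAlgebra
  have hψ' : Function.Surjective (Algebra.linearMap R A) := hψ
  have := hA.noetherian
  have : Module.Finite R A := Module.Finite.of_surjective _ hψ'
  obtain ⟨rs', hmem, hreg, hlen⟩ := hA.exists_regular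
  obtain ⟨rs, rfl⟩ := List.map_surjective_iff.2 hψ rs'
  have hdim := ringKrullDim_add_length_eq_ringKrullDim_of_isRegular _ hreg
  -- The regular sequence has length `dim A`, so the quotient has dimension `0` and a power of the
  -- maximal ideal lies in the ideal of the sequence.
  have hart : IsArtinianRing (A ⧸ Ideal.ofList (rs.map ψ)) := by
    rw [← hlen] at hdim
    rw [isArtinianRing_iff_krullDimLE_zero, Ring.krullDimLE_iff,
      ← ENat.WithBot.add_le_add_natCast_right_iff (c := (rs.map ψ).length), hdim]
    simp
  obtain ⟨k, hk⟩ := exists_maximalIdeal_pow_le_of_isArtinianRing_quotient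
    (Ideal.ofList (rs.map ψ))
  have hle := projectiveDimension_add_length_le hxs hmax A (rs := rs)
    ((isWeaklyRegular_map_algebraMap_iff A A rs).1 hreg.toIsWeaklyRegular)
    (fun r hr => by
      have h1 := hmem _ (List.mem_map_of_mem hr)
      rw [mem_maximalIdeal, mem_nonunits_iff] at h1 ⊢
      exact fun h => h1 (h.map ψ)) k
    (fun r hr x => by
      rw [Ideal.smul_top_eq_map, Submodule.restrictScalars_mem, Algebra.smul_def]
      refine Ideal.mul_mem_right _ _ ?_
      rw [Ideal.map_ofList]
      refine hk (Ideal.pow_right_mono ?_ k (Ideal.map_pow (algebraMap R A) _ k ▸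
        Ideal.mem_map_of_mem (algebraMap R A) hr))
      refine Ideal.map_le_iff_le_comap.2 (eq_maximalIdeal ?_).ge
      exact Ideal.comap_isMaximal_of_surjective _ hψ)
  -- Here `pd A + rs.length ≤ xs.length ≤ d + 2`, while `rs.length = dim A ≥ d`.
  have hpd : HasProjectiveDimensionLE (ModuleCat.of R A) 2 := by
    rw [← projectiveDimension_le_iff]
    have h2 : (d : WithBot ℕ∞) ≤ rs.length := by
      simpa using hd.trans hlen.symm.le
    rw [← ENat.WithBot.add_le_add_natCast_right_iff (c := rs.length)]
    refine hle.trans ?_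
    norm_cast at h2 ⊢
    omega
  exact free_ker_linearCombination A hψ' g hg

end LocalRing

/-! ### Ideals generated by variables -/

section Variables

variable {K : Type*} [Field K] {σ : Type*}

/-- Setting the variables in `W` to zero. -/
lemma aeval_eq_zero_iff_mem_span_X (W : Set σ) [DecidablePred (· ∈ W)] (f : MvPolynomial σ K) :
    aeval (fun i => if i ∈ W then (0 : MvPolynomial σ K) else X i) f = 0 ↔
      f ∈ Ideal.span (X '' W) := by
  set φ := aeval (R := K) (fun i => if i ∈ W then (0 : MvPolynomial σ K) else X i) with hφ
  constructor
  · intro h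
    have key : ∀ f : MvPolynomial σ K, f - φ f ∈ Ideal.span (X '' W) := by
      intro f
      induction f using MvPolynomial.induction_on with
      | C a => simp [hφ]
      | add p q hp hq =>
        rw [map_add, add_sub_add_comm]
        exact add_mem hp hq
      | mul_X p i hp =>
        have : p * X i - φ (p * X i) = (p - φ p) * X i + φ p * (X i - φ (X i)) := by
          rw [map_mul]
          ring
        rw [this]
        refine add_mem (Ideal.mul_mem_right _ _ hp) (Ideal.mul_mem_left _ _ ?_)
        rw [hφ, aeval_X]
        split_ifs with hi
        · rw [sub_zero]
          exact Ideal.subset_span ⟨i, hi, rfl⟩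
        · rw [sub_self]
          exact zero_mem _
    simpa [h] using key f
  · intro h
    have : Ideal.span (X '' W) ≤ RingHom.ker φ.toRingHom := by
      rw [Ideal.span_le]
      rintro _ ⟨i, hi, rfl⟩
      change φ (X i) = 0
      rw [hφ, aeval_X, if_pos hi]
    exact this h

lemma isPrime_span_X_image (W : Set σ) :
    (Ideal.span (X '' W) : Ideal (MvPolynomial σ K)).IsPrime := by
  classical
  have : Ideal.span (X '' W) = RingHom.ker
      (aeval (R := K) (fun i => if i ∈ W then (0 : MvPolynomial σ K) else X i)).toRingHom := by
    ext f
    rw [← aeval_eq_zero_iff_mem_span_X]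
    rfl
  rw [this]
  exact RingHom.ker_isPrime _

lemma X_mem_span_X_image_iff {W : Set σ} {i : σ} :
    (X i : MvPolynomial σ K) ∈ Ideal.span (X '' W) ↔ i ∈ W := by
  classical
  rw [← aeval_eq_zero_iff_mem_span_X, aeval_X]
  split_ifs with h
  · simp [h]
  · simp [h, X_ne_zero]

/-- Adjoining the variables of `W` one at a time gives a strictly increasing chain of primes above
the kernel. With `f` the identity this bounds the number of variables in a prime; with `f` a
quotient map it bounds the dimension of the quotient from below. -/
lemma card_le_height_map_span_X {B : Type*} [CommRing B] {f : MvPolynomial σ K →+* B}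
    (hf : Function.Surjective f) {V : Set σ} (hV : RingHom.ker f ≤ Ideal.span (X '' V))
    (W : Finset σ) (hVW : Disjoint V W) :
    (W.card : ℕ∞) ≤ (Ideal.map f (Ideal.span (X '' (V ∪ W)))).height := by
  classical
  induction W using Finset.induction_on with
  | empty => simp
  | insert a W ha ih =>
    have hle : ∀ W : Finset σ, RingHom.ker f ≤ Ideal.span (X '' (V ∪ W)) := fun W =>
      hV.trans (Ideal.span_mono (Set.image_mono Set.subset_union_left))
    have hpr : ∀ W : Finset σ, (Ideal.map f (Ideal.span (X '' (V ∪ W)))).IsPrime := fun W => by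
      have := isPrime_span_X_image (K := K) (V ∪ (W : Set σ))
      exact Ideal.map_isPrime_of_surjective hf (hle W)
    have h1 := hpr W
    have h2 := hpr (insert a W)
    have ha' : a ∉ V ∪ (W : Set σ) := by
      rintro (h | h)
      · exact Set.disjoint_left.1 hVW h (by simp)
      · exact ha h
    have hlt : Ideal.map f (Ideal.span (X '' (V ∪ W))) <
        Ideal.map f (Ideal.span (X '' (V ∪ (insert a W : Finset σ)))) := by
      refine lt_of_le_not_ge (Ideal.map_mono (Ideal.span_mono (Set.image_mono
        (Set.union_subset_union_right _ (by simp))))) fun h => ha' ?_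
      have h3 : f (X a) ∈ Ideal.map f (Ideal.span (X '' (V ∪ W))) :=
        h (Ideal.mem_map_of_mem f (Ideal.subset_span ⟨a, by simp, rfl⟩))
      rw [← Ideal.mem_comap, Ideal.comap_map_of_surjective' f hf, sup_eq_left.2 (hle W)] at h3
      exact X_mem_span_X_image_iff.1 h3
    have h3 := Ideal.height_add_one_le_of_lt_of_isPrime hlt
    rw [Finset.card_insert_of_notMem ha, Nat.cast_add, Nat.cast_one]
    refine le_trans ?_ h3
    gcongr
    exact ih (hVW.mono_right (by simp))

lemma span_range_X_eq_ker_constantCoeff :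
    Ideal.span (Set.range (X : σ → MvPolynomial σ K)) =
      RingHom.ker (constantCoeff (R := K) (σ := σ)) := by
  ext f
  have := mem_pow_idealOfVars_iff' (R := K) (σ := σ) 1 f
  rw [pow_one] at this
  rw [this, RingHom.mem_ker, constantCoeff_eq]
  constructor
  · intro h
    exact h 0 (by simp)
  · intro h x hx
    rw [Nat.lt_one_iff, Finsupp.degree_eq_zero_iff] at hx
    rwa [hx]

lemma isMaximal_span_range_X :
    (Ideal.span (Set.range (X : σ → MvPolynomial σ K))).IsMaximal := by
  rw [span_range_X_eq_ker_constantCoeff]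
  exact RingHom.ker_isMaximal_of_surjective _ fun a => ⟨C a, constantCoeff_C _ _⟩

lemma ofList_take_ofFn_X {n : ℕ} (k : ℕ) :
    Ideal.ofList ((List.ofFn (X : Fin n → MvPolynomial (Fin n) K)).take k) =
      Ideal.span (X '' {i : Fin n | (i : ℕ) < k}) := by
  rw [Ideal.ofList]
  congr 1
  ext f
  simp only [Set.mem_ofPred_eq, List.mem_take_iff_getElem, List.length_ofFn, List.getElem_ofFn,
    Set.mem_image]
  constructor
  · rintro ⟨i, hi, rfl⟩
    exact ⟨⟨i, by omega⟩, by simp; omega, rfl⟩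
  · rintro ⟨i, hi, rfl⟩
    exact ⟨i, by omega, rfl⟩

/-- The first `k` variables generate a prime ideal that does not contain the next variable. -/
lemma isWeaklyRegular_X (n : ℕ) :
    RingTheory.Sequence.IsWeaklyRegular (MvPolynomial (Fin n) K)
      (List.ofFn (X : Fin n → MvPolynomial (Fin n) K)) := by
  rw [RingTheory.Sequence.isWeaklyRegular_iff_Fin]
  intro k
  have hk : (k : ℕ) < n := by simpa using k.2
  rw [isSMulRegular_quotient_iff_mem_of_smul_mem]
  intro f hf
  rw [ofList_take_ofFn_X, smul_eq_mul, Ideal.mul_top] at hf ⊢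
  have hp := isPrime_span_X_image (K := K) {i : Fin n | (i : ℕ) < k}
  refine (hp.mem_or_mem hf).resolve_left fun h => ?_
  rw [Fin.getElem_fin, List.getElem_ofFn, X_mem_span_X_image_iff] at h
  simp at h

/-- An ideal of height `h` generated by monomials is contained in an ideal generated by at
most `h` variables. -/
lemma exists_span_X_image_ge_of_height_eq {n m : ℕ} {I : Ideal (MvPolynomial (Fin n) K)}
    {u : Fin (m + 1) → (Fin n →₀ ℕ)}
    (hI : I = Ideal.span (Set.range fun i => monomial (u i) (1 : K))) {h : ℕ}
    (hh : I.height = h) :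
    ∃ V : Finset (Fin n), V.card ≤ h ∧ I ≤ Ideal.span (X '' (V : Set (Fin n))) := by
  classical
  obtain ⟨P, hP, hPh⟩ : ∃ P ∈ I.minimalPrimes, P.height ≤ h := by
    by_contra! hlt
    have h1 : (h : ℕ∞) + 1 ≤ I.height := by
      rw [Ideal.height_eq_inf_minimalPrimes]
      exact le_iInf₂ fun P hP => Order.add_one_le_of_lt (hlt P hP)
    rw [hh] at h1
    norm_cast at h1
    omega
  have hPp := hP.isPrime
  -- The variables in a minimal prime `P` of height at most `h`. They generate an ideal inside `P`,
  -- of height at least `V.card`; each generator of `I` lies in `P`, so one of its variables does.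
  set V : Finset (Fin n) := Finset.univ.filter fun i => (X i : MvPolynomial (Fin n) K) ∈ P with hV
  refine ⟨V, ?_, ?_⟩
  · have h1 := card_le_height_map_span_X (K := K) (f := RingHom.id _) (V := ∅)
      Function.surjective_id
      (((RingHom.injective_iff_ker_eq_bot _).1 Function.injective_id).le.trans bot_le) V (by simp)
    rw [Ideal.map_id, Set.empty_union] at h1
    have h2 : Ideal.span (X '' (V : Set (Fin n))) ≤ P := by
      rw [Ideal.span_le]
      rintro _ ⟨i, hi, rfl⟩
      simpa [hV] using hi
    exact_mod_cast (h1.trans (Ideal.height_mono h2)).trans hPh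
  · rw [hI, Ideal.span_le]
    rintro _ ⟨i, rfl⟩
    have h1 : monomial (u i) (1 : K) ∈ P := hP.le (hI ▸ Ideal.subset_span ⟨i, rfl⟩)
    rw [monomial_eq, C_1, one_mul, Finsupp.prod, hPp.prod_mem_iff] at h1
    obtain ⟨j, hj, hjP⟩ := h1
    have hj' : u i j ≠ 0 := Finsupp.mem_support_iff.1 hj
    have hXj : (X j : MvPolynomial (Fin n) K) ∈ P := hPp.mem_of_pow_mem _ hjP
    rw [SetLike.mem_coe, mem_ideal_span_X_image]
    intro b hb
    rw [Finset.mem_singleton.1 (support_monomial_subset hb)]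
    exact ⟨j, by simpa [hV] using hXj, hj'⟩

end Variables

/-! ### Passage between the syzygies and their localization at the origin -/

section Syzygies

variable {K : Type*} [Field K] {n m : ℕ}

/-- If the localization of the syzygy module at the irrelevant ideal is free, then the syzygy module
is generated by `m` elements modulo the irrelevant ideal. -/
lemma exists_syzygies_le_span_sup_of_free (u : Fin (m + 1) → (Fin n →₀ ℕ))
    {𝔪 : Ideal (MvPolynomial (Fin n) K)} [𝔪.IsPrime]
    (h𝔪 : 𝔪 = Ideal.span (Set.range (X : Fin n → MvPolynomial (Fin n) K)))
    (R : Type*) [CommRing R] [Algebra (MvPolynomial (Fin n) K) R] [IsLocalization.AtPrime R 𝔪]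
    [Module.Free R (LinearMap.ker (Fintype.linearCombination R fun i =>
      algebraMap (MvPolynomial (Fin n) K) R (monomial (u i) 1)))] :
    ∃ g : Fin m → (Fin (m + 1) → MvPolynomial (Fin n) K),
      (syzygies K u).restrictScalars K ≤
        Submodule.span K (Set.range g) ⊔ (radSyzygies K u).restrictScalars K := by
  have hinj : Function.Injective (algebraMap (MvPolynomial (Fin n) K) R) :=
    IsLocalization.injective R 𝔪.primeCompl_le_nonZeroDivisors
  set v : Fin (m + 1) → R := fun i =>
    algebraMap (MvPolynomial (Fin n) K) R (monomial (u i) 1) with hv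
  set φ := Fintype.linearCombination R v with hφ
  have : IsNoetherianRing R := IsLocalization.isNoetherianRing 𝔪.primeCompl R inferInstance
  have : IsDomain R :=
    IsLocalization.isDomain_of_le_nonZeroDivisors R 𝔪.primeCompl_le_nonZeroDivisors
  have hrank : Module.finrank R (LinearMap.ker φ) = m := by
    refine finrank_ker_linearCombination v fun h => ?_
    have h0 := congrFun h 0
    rw [hv, Pi.zero_apply, map_eq_zero_iff _ hinj] at h0
    simp at h0
  have hmap : ∀ f : Fin (m + 1) → MvPolynomial (Fin n) K,
      φ (fun l => algebraMap (MvPolynomial (Fin n) K) R (f l)) =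
      algebraMap (MvPolynomial (Fin n) K) R (generatorMap K u f) := by
    intro f
    rw [hφ, generatorMap, Fintype.linearCombination_apply, Fintype.linearCombination_apply, map_sum]
    simp [hv]
  -- A basis of the localized kernel, multiplied by a common denominator `t`, gives the polynomial
  -- syzygies `g`.
  let b := Module.finBasisOfFinrankEq R (LinearMap.ker φ) hrank
  obtain ⟨t, ht⟩ := IsLocalization.exist_integer_multiples_of_finite 𝔪.primeCompl
    (fun p : Fin m × Fin (m + 1) => (b p.1 : Fin (m + 1) → R) p.2)
  choose g hg using fun k l => ht (k, l)
  have hgsyz : Set.range g ⊆ syzygies K u := by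
    rintro _ ⟨k, rfl⟩
    rw [SetLike.mem_coe, LinearMap.mem_ker, ← map_eq_zero_iff _ hinj, ← hmap,
      show (fun l => algebraMap (MvPolynomial (Fin n) K) R (g k l)) =
        algebraMap (MvPolynomial (Fin n) K) R t • (b k : Fin (m + 1) → R) by
        ext l
        rw [hg, Pi.smul_apply, algebraMap_smul], map_smul, LinearMap.mem_ker.1 (b k).2, smul_zero]
  refine ⟨g, fun x hx => ?_⟩
  have hx : x ∈ syzygies K u := hx
  have hxker : (fun l => algebraMap (MvPolynomial (Fin n) K) R (x l)) ∈ LinearMap.ker φ := by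
    rw [LinearMap.mem_ker, hmap, LinearMap.mem_ker.1 hx, map_zero]
  -- With `s` a common denominator of the coordinates of `x`, the multiple `(s * t) • x` is a
  -- polynomial combination of the `g k`.
  obtain ⟨s, hs⟩ := IsLocalization.exist_integer_multiples_of_finite 𝔪.primeCompl
    (fun k => b.repr ⟨_, hxker⟩ k)
  choose a ha using hs
  have hlin : ((s * t : MvPolynomial (Fin n) K)) • x = ∑ k, a k • g k := by
    ext1 l
    apply hinj
    have h1 := congrFun (congrArg Subtype.val (b.sum_repr ⟨_, hxker⟩)) l
    simp only [AddSubmonoidClass.coe_finsetSum, Finset.sum_apply, SetLike.val_smul,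
      Pi.smul_apply] at h1
    simp only [Finset.sum_apply, Pi.smul_apply, smul_eq_mul, map_mul, map_sum, ha, hg, ← h1]
    simp only [Finset.mul_sum, Algebra.smul_def]
    exact Finset.sum_congr rfl fun k _ => by ring
  -- Lying outside `𝔪` means having nonzero constant term `c`. Modulo `𝔪Z`, multiplication by `s *
  -- t` is multiplication by `c`, which can be inverted.
  have hc : constantCoeff ((s * t : MvPolynomial (Fin n) K)) ≠ 0 := by
    intro h
    rw [← RingHom.mem_ker, ← span_range_X_eq_ker_constantCoeff, ← h𝔪] at h
    exact mul_mem s.2 t.2 h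
  have h1 : ((s * t : MvPolynomial (Fin n) K)) • x ∈
      Submodule.span K (Set.range g) ⊔ (radSyzygies K u).restrictScalars K := by
    refine span_le_sup_radSyzygies u hgsyz ?_
    rw [hlin]
    exact Submodule.sum_mem (Submodule.span (MvPolynomial (Fin n) K) (Set.range g)) fun k _ =>
      Submodule.smul_mem _ _ (Submodule.subset_span ⟨k, rfl⟩)
  set c := constantCoeff ((s * t : MvPolynomial (Fin n) K)) with hcdef
  have h2 : ((s * t : MvPolynomial (Fin n) K) - C c) • x ∈ radSyzygies K u := by
    refine Submodule.smul_mem_smul ?_ hx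
    rw [span_range_X_eq_ker_constantCoeff, RingHom.mem_ker, map_sub, constantCoeff_C, sub_self]
  have h3 : x =
      c⁻¹ • (((s * t : MvPolynomial (Fin n) K)) • x - ((s * t : MvPolynomial (Fin n) K) - C c) • x) := by
    rw [← sub_smul, sub_sub_cancel, ← algebraMap_eq, algebraMap_smul, inv_smul_smul₀ hc]
  rw [h3]
  exact Submodule.smul_mem _ _ (sub_mem h1 (Submodule.mem_sup_right h2))

/-- The localized syzygy module of a Cohen-Macaulay monomial ideal of height two is free. -/
lemma free_localized_syzygies {I : Ideal (MvPolynomial (Fin n) K)}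
    {u : Fin (m + 1) → (Fin n →₀ ℕ)}
    (hI : I = Ideal.span (Set.range fun i => monomial (u i) (1 : K)))
    (hcm : IsCohenMacaulayRing (MvPolynomial (Fin n) K ⧸ I)) (hcodim : I.height = 2)
    {𝔪 : Ideal (MvPolynomial (Fin n) K)} [𝔪.IsPrime]
    (h𝔪 : 𝔪 = Ideal.span (Set.range (X : Fin n → MvPolynomial (Fin n) K))) :
    Module.Free (Localization.AtPrime 𝔪) (LinearMap.ker (Fintype.linearCombination
      (Localization.AtPrime 𝔪) fun i =>
        algebraMap (MvPolynomial (Fin n) K) (Localization.AtPrime 𝔪) (monomial (u i) 1))) := by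
  classical
  set R := Localization.AtPrime 𝔪
  have : IsNoetherianRing R := IsLocalization.isNoetherianRing 𝔪.primeCompl R inferInstance
  obtain ⟨V, hVcard, hIV⟩ := exists_span_X_image_ge_of_height_eq hI (h := 2) hcodim
  set mk := Ideal.Quotient.mk I
  have hmk : Function.Surjective mk := Ideal.Quotient.mk_surjective
  have hker : RingHom.ker mk = I := Ideal.mk_ker
  have huniv : Ideal.span (X '' ((V : Set (Fin n)) ∪ (Vᶜ : Finset (Fin n)))) = 𝔪 := by
    rw [Finset.coe_compl, Set.union_compl_self, Set.image_univ, h𝔪]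
  have hI𝔪 : I ≤ 𝔪 := by
    rw [← huniv]
    exact hIV.trans (Ideal.span_mono (Set.image_mono Set.subset_union_left))
  have hmax : 𝔪.IsMaximal := h𝔪 ▸ isMaximal_span_range_X
  set p := 𝔪.map mk with hp
  have hpcomap : p.comap mk = 𝔪 := by
    rw [hp, Ideal.comap_map_of_surjective' mk hmk, hker, sup_eq_left.2 hI𝔪]
  have hpp : p.IsPrime := Ideal.map_isPrime_of_surjective hmk (hker.le.trans hI𝔪)
  have hpmax : p.IsMaximal := by
    refine (Ideal.map_eq_top_or_isMaximal_of_surjective mk hmk hmax).resolve_left hpp.ne_top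
  -- Adjoining the variables outside `V` to the prime generated by `V` gives a chain of length `n -
  -- V.card` below the image of `𝔪` in the quotient by `I`.
  have hheight := card_le_height_map_span_X hmk (V := V) (hker.le.trans hIV) Vᶜ (by
    rw [Finset.coe_compl]
    exact disjoint_compl_right)
  rw [huniv, Finset.card_compl, Fintype.card_fin] at hheight
  have hsurj : Function.Surjective (Localization.localRingHom 𝔪 p mk hpcomap.symm) :=
    (RingHom.surjectiveOnStalks_of_surjective hmk).localRingHom_surjective _ _ _
  have hxs : Ideal.ofList ((List.ofFn (X : Fin n → MvPolynomial (Fin n) K)).map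
      (algebraMap (MvPolynomial (Fin n) K) R)) =
      IsLocalRing.maximalIdeal R := by
    have h1 : Ideal.ofList (List.ofFn (X : Fin n → MvPolynomial (Fin n) K)) = 𝔪 := by
      rw [h𝔪, Ideal.ofList]
      congr 1
      ext f
      simp
    rw [← Ideal.map_ofList, ← Localization.AtPrime.map_eq_maximalIdeal, h1]
  -- The choice `d = n - V.card` works because `V` has at most two elements, so that `n ≤ d + 2`.
  refine free_ker_linearCombination_of_isCohenMacaulayLocalRing (xs := _) ?_ hxs
    (hcm.localization p) hsurj (d := n - V.card) ?_ ?_ _ ?_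
  · refine .of_isWeaklyRegular_of_mem_maximalIdeal R ?_ (isWeaklyRegular_X n).of_flat
    intro r hr
    rw [← hxs]
    exact Ideal.subset_span hr
  · rw [IsLocalization.AtPrime.ringKrullDim_eq_height p]
    rw [← WithBot.coe_natCast, WithBot.coe_le_coe]
    exact hheight
  · simp
    omega
  · have h1 : Ideal.map (algebraMap (MvPolynomial (Fin n) K) R) I =
        Ideal.span (Set.range fun i => algebraMap (MvPolynomial (Fin n) K) R (monomial (u i) 1)) := by
      rw [hI, Ideal.map_span, ← Set.range_comp]
      rfl
    rw [← h1]
    refine le_antisymm (fun x hx => ?_) (Ideal.map_le_iff_le_comap.2 fun x hx => ?_)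
    -- A fraction `a / s` dies in the localized quotient only if `c * a ∈ I` for some `c ∉ 𝔪`, that
    -- is, if it lies in the extension of `I`.
    · obtain ⟨a, s, rfl⟩ := IsLocalization.exists_mk'_eq 𝔪.primeCompl x
      rw [RingHom.mem_ker, Localization.localRingHom_mk', IsLocalization.mk'_eq_zero_iff] at hx
      obtain ⟨⟨c, hc⟩, hca⟩ := hx
      obtain ⟨c, rfl⟩ := hmk c
      rw [← map_mul, Ideal.Quotient.eq_zero_iff_mem] at hca
      have hc' : c ∈ 𝔪.primeCompl := fun h => hc (Ideal.mem_map_of_mem mk h)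
      rw [IsLocalization.mk'_mem_map_algebraMap_iff 𝔪.primeCompl]
      exact ⟨c, hc', hca⟩
    · rw [Ideal.mem_comap, RingHom.mem_ker, Localization.localRingHom_to_map,
        Ideal.Quotient.eq_zero_iff_mem.2 hx, map_zero]

end Syzygies

end RelationTrees

end

theorem proposition2p5 {K : Type*} [Field K] {n m : ℕ}
    (I : Ideal (MvPolynomial (Fin n) K)) (u : Fin (m + 1) → (Fin n →₀ ℕ))
    (hu : RelationTrees.IsMinimalMonomialGenerators I u)
    (hcm : RelationTrees.IsCohenMacaulayRing (MvPolynomial (Fin n) K ⧸ I))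
    (hcodim : I.height = 2) :
    (∀ Γ ∈ RelationTrees.relationTrees K u, Γ.IsTree) ∧
    ∃ M : Matroid (Sym2 (Fin (m + 1))),
      M.E = (⊤ : SimpleGraph (Fin (m + 1))).edgeSet ∧
      ∀ B : Set (Sym2 (Fin (m + 1))),
        M.IsBase B ↔ ∃ Γ ∈ RelationTrees.relationTrees K u, Γ.edgeSet = B := by
  refine ⟨fun Γ hΓ => RelationTrees.isTree_of_mem_relationTrees hu.not_dvd hΓ, ?_⟩
  have hprime : (Ideal.span (Set.range (X : Fin n → MvPolynomial (Fin n) K))).IsPrime :=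
    RelationTrees.isMaximal_span_range_X.isPrime
  have hfree := RelationTrees.free_localized_syzygies hu.span_eq hcm hcodim rfl
  obtain ⟨g, hg⟩ := RelationTrees.exists_syzygies_le_span_sup_of_free (K := K) u rfl
    (Localization.AtPrime (Ideal.span (Set.range (X : Fin n → MvPolynomial (Fin n) K))))
  exact RelationTrees.exists_matroid_of_syzygies_le hu.not_dvd g hg
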